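/- **Setting.** Let $d,k\ge 0$ be integers and let $\Theta\subseteq\mathbb R^k$ be open. Let $\mathbf p:\Theta\to\mathbb R^d$ be such that - $\mathbf p(\theta)$ is a probability vector for every $\theta\in\Theta$; - $\mathbf p$ is bicontinuous on $\Theta$, i.e. for $\theta_j,\theta\in\Theta$ one has $\theta_j\to\theta$ if and only if $\mathbf p(\theta_j)\to\mathbf p(\theta)$; - $\mathbf p$ has continuous first partial derivatives on $\Theta$, and its Jacobian has full rank $k$ at every $\theta\in\Theta$. Extend $\mathbf p$ to a Borel function on $\mathbb R^k$ in an arbitrary way. Let $\theta^0\in\Theta$ be the true parameter (the null hypothesis $H_0$), and let $\rho_n>0$. For each $n$ let $X^{(n)}\sim\mathrm{Multinomial}(n,\mathbf p(\theta^0))$ and $Z^{(n)}\sim N(0,\tfrac1{\rho_n}I_d)$ be independent random vectors, all defined on one probability space, and put $Y^{(n)}=X^{(n)}+Z^{(n)}$. Let $\phi:\mathbb R^d\to\mathbb R^k$ be a Borel function with $\phi(Y^{(n)})\to\theta^0$ in probability. **Statistics.** For $r>0$ put $$\Sigma_r(\theta)=\mathrm{Diag}(\mathbf p(\theta))-\mathbf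 p(\theta)\mathbf p(\theta)^{\intercal}+\tfrac1r I_d,\qquad P=I_d-\tfrac1d\mathbf 1\mathbf 1^{\intercal},$$ $$U_n(\theta)=\sqrt n\Bigl(\tfrac{Y^{(n)}}{n}-\mathbf p(\theta)\Bigr),\qquad \hat M_n=\Sigma_{n\rho_n}\bigl(\phi(Y^{(n)})\bigr)^{-1}.$$ (Where that matrix is singular, which can happen only if $\phi(Y^{(n)})\notin\Theta$ or $n=0$, set $\hat M_n=0$.) The unprojected and the projected statistic are $$R^{(n)}_{\rho_n}(\theta)=U_n(\theta)^{\intercal}\hat M_n U_n(\theta),\qquad \hat R^{(n)}_{\rho_n}(\theta)=U_n(\theta)^{\intercal}P\hat M_nP\,U_n(\theta).$$ For $T_n=R^{(n)}_{\rho_n}$ or $T_n=\hat R^{(n)}_{\rho_n}$, write $\hat\theta^{(n)}=\arg\min_{\theta\in\Theta}T_n(\theta)$ for any sequence of random vectors $\hat\theta^{(n)}$ in $\mathbb R^k$ such that, with probability tending to one as $n\to\infty$, $\hat\theta^{(n)}\in\Theta$ and $\hat\theta^{(n)}$ minimizes $T_n$ over $\Theta$. (Since $\Theta$ is open, a minimizer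 need not exist for every outcome.) **Theorem.** As $n\to\infty$: 1. If $n\rho_n\to\rho$ for some real $\rho>0$ and $\hat\theta^{(n)}=\arg\min_{\theta\in\Theta}R^{(n)}_{\rho_n}(\theta)$, then $R^{(n)}_{\rho_n}(\hat\theta^{(n)})\to\chi^2_{d-k}$ in distribution. 2. If $n\rho_n\to\rho$ for some real $\rho>0$ and $\hat\theta^{(n)}=\arg\min_{\theta\in\Theta}\hat R^{(n)}_{\rho_n}(\theta)$, then $\hat R^{(n)}_{\rho_n}(\hat\theta^{(n)})\to\chi^2_{d-k-1}$ in distribution. 3. If $n\rho_n\to\infty$, every component of $\mathbf p(\theta^0)$ is positive, and $\hat\theta^{(n)}=\arg\min_{\theta\in\Theta}\hat R^{(n)}_{\rho_n}(\theta)$, then $\hat R^{(n)}_{\rho_n}(\hat\theta^{(n)})\to\chi^2_{d-k-1}$ in distribution. Here $\chi^2_m$ is the law of the sum of squares of $m$ independent standard normal variables, so $\chi^2_0$ is the point mass at $0$. The hypotheses force $k\le d-1$, so the degrees of freedom are never negative. -/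

import Mathlib

open MeasureTheory ProbabilityTheory Filter Topology

noncomputable section

/-- `ℝᵐ` with its Euclidean structure. -/
abbrev Vec (m : ℕ) : Type := EuclideanSpace ℝ (Fin m)

/-! ### Probability distributions -/

/-- The law of one categorical trial: outcome `i` has probability `q i`. -/
def categorical {d : ℕ} (q : Vec d) : Measure (Fin d) :=
  ∑ i : Fin d, ENNReal.ofReal (q i) • Measure.dirac i

/-- The histogram of a sequence of `n` outcomes: coordinate `i` counts the outcomes equal to `i`. -/
def histogram {d n : ℕ} (s : Fin n → Fin d) : Vec d :=
  WithLp.toLp 2 fun i => ((Finset.univ.filter fun j : Fin n => s j = i).card : ℝ)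

/-- `Multinomial(n, q)`: the law of the histogram of `n` independent trials, each with
outcome probabilities `q`. -/
def multinomial {d : ℕ} (n : ℕ) (q : Vec d) : Measure (Vec d) :=
  (Measure.pi fun _ : Fin n => categorical q).map histogram

/-- The chi-square distribution with `m` degrees of freedom: the law of the sum of the squares
of `m` independent standard normal variables (the point mass at `0` if `m = 0`). -/
def chiSquare (m : ℕ) : Measure ℝ :=
  (Measure.pi fun _ : Fin m => gaussianReal 0 1).map fun x => ∑ i, x i ^ 2

instance isProbabilityMeasure_chiSquare (m : ℕ) : IsProbabilityMeasure (chiSquare m) :=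
  Measure.isProbabilityMeasure_map (Measurable.aemeasurable (by fun_prop))

/-! ### The model -/

/-- `A` is bicontinuous on `Θ`: `θ_j → θ` if and only if `A θ_j → A θ`, for points of `Θ`. -/
def BicontinuousOn {d k : ℕ} (A : Vec k → Vec d) (Θ : Set (Vec k)) : Prop :=
  ∀ u : ℕ → Vec k, (∀ j, u j ∈ Θ) → ∀ θ ∈ Θ,
    (Tendsto u atTop (𝓝 θ) ↔ Tendsto (fun j => A (u j)) atTop (𝓝 (A θ)))

/-- The regularity conditions on a multinomial model `θ ↦ p θ`, `θ ∈ Θ ⊆ ℝᵏ`. -/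
structure IsRegularModel {d k : ℕ} (Θ : Set (Vec k)) (p : Vec k → Vec d) : Prop where
  isOpen : IsOpen Θ
  /-- `p θ` is a probability vector for every parameter `θ`. -/
  nonneg : ∀ θ ∈ Θ, ∀ i, 0 ≤ p θ i
  sum_eq_one : ∀ θ ∈ Θ, ∑ i, p θ i = 1
  bicontinuous : BicontinuousOn p Θ
  /-- `p` has continuous first partial derivatives on the open set `Θ`. -/
  contDiffOn : ContDiffOn ℝ 1 p Θ
  /-- The Jacobian of `p` has full rank `k`. -/
  rank_eq : ∀ θ ∈ Θ, Module.finrank ℝ (LinearMap.range (fderiv ℝ p θ).toLinearMap) = k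

/-! ### The statistics -/

/-- `√n (y / n - p θ)`, where `y` is the noisy histogram. -/
def scaledDeviation {d k : ℕ} (p : Vec k → Vec d) (n : ℕ) (y : Vec d) (θ : Vec k) : Vec d :=
  √(n : ℝ) • ((n : ℝ)⁻¹ • y - p θ)

/-- `Σ_r(θ) = Diag(p θ) - (p θ)(p θ)ᵀ + (1 / r) I`. -/
def privCovar {d k : ℕ} (p : Vec k → Vec d) (r : ℝ) (θ : Vec k) : Matrix (Fin d) (Fin d) ℝ :=
  Matrix.diagonal (p θ).ofLp - Matrix.vecMulVec (p θ).ofLp (p θ).ofLp + (1 / r) • 1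

/-- The plug-in middle matrix `Σ_{nρ}(φ y)⁻¹`. -/
def middleMatrix {d k : ℕ} (p : Vec k → Vec d) (φ : Vec d → Vec k) (n : ℕ) (ρ : ℝ) (y : Vec d) :
    Matrix (Fin d) (Fin d) ℝ :=
  (privCovar p (n * ρ) (φ y))⁻¹

/-- The projection `I - (1 / d) 𝟏𝟏ᵀ` onto the orthogonal complement of the all-ones vector. -/
def centering (d : ℕ) : Matrix (Fin d) (Fin d) ℝ :=
  1 - (1 / (d : ℝ)) • Matrix.of fun _ _ => 1

/-- The unprojected statistic, at the noisy histogram `y`, as a function of `θ`. -/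
def unprojectedStat {d k : ℕ} (p : Vec k → Vec d) (φ : Vec d → Vec k) (n : ℕ) (ρ : ℝ) (y : Vec d)
    (θ : Vec k) : ℝ :=
  (scaledDeviation p n y θ).ofLp ⬝ᵥ
    (middleMatrix p φ n ρ y).mulVec (scaledDeviation p n y θ).ofLp

/-- The projected statistic, at the noisy histogram `y`, as a function of `θ`. -/
def projectedStat {d k : ℕ} (p : Vec k → Vec d) (φ : Vec d → Vec k) (n : ℕ) (ρ : ℝ) (y : Vec d)
    (θ : Vec k) : ℝ :=
  (scaledDeviation p n y θ).ofLp ⬝ᵥ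
    (centering d * middleMatrix p φ n ρ y * centering d).mulVec (scaledDeviation p n y θ).ofLp

/-- `est n` is a random vector which, with probability tending to one as `n → ∞`, is a point of
`Θ` at which the random function `T n ω` attains its minimum over `Θ`.  Since `Θ` is open, a
minimizer need not exist at every sample point. -/
structure IsMinChiSqEstimator {k : ℕ} {Ω : Type*} [MeasurableSpace Ω] (P : Measure Ω)
    (Θ : Set (Vec k)) (T : ℕ → Ω → Vec k → ℝ) (est : ℕ → Ω → Vec k) : Prop where
  aemeasurable : ∀ n, AEMeasurable (est n) P
  argmin : Tendsto (fun n => P {ω | ¬ (est n ω ∈ Θ ∧ IsMinOn (T n ω) Θ (est n ω))}) atTop (𝓝 0)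

end

open MeasureTheory ProbabilityTheory Filter Topology

noncomputable section

/-! Let `a` be the limit of `1 / (n ρ_n)` and `W` the scaled deviation at `θ₀`. A central limit
argument makes `W` asymptotically `N(0, covar (p θ₀) a)` (`tendsto_charFun_scaled`). At scale `1/√n`
the model is its tangent space, the range of the Jacobian `J`, so minimizing the statistic becomes
generalized least squares: minimize `(w - J h)ᵀ G⁻¹ (w - J h)` over `h`. The minimum is `‖B w‖²`,
where `B` whitens `G` and discards the tangent directions (`exists_residual_map`). Hence `B W` tends
to a standard Gaussian and the statistic to a chi-square law.

The projected statistic only sees vectors orthogonal to the all-ones vector, on which `covar` and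
`covar + averaging` have the same inverse form (`quad_inv_covar_eq`). The second matrix stays
invertible in the limit `a = 0` when all cell probabilities are positive, whereas `covar` itself
then kills the all-ones vector. The three claims are therefore one theorem,
`NoisyMultinomial.tendstoInDistribution`, with a removed direction `e` that is `0` (unprojected) or
all-ones (projected, one degree of freedom lost).

That the statistic differs from `‖B W‖²` by `o(1)` in probability is a deterministic fact, uniform
over bounded deviations and over all minimizers (`eventually_abs_quad_minimizer_sub_lt`).
Probability enters only through tightness of `W`, consistency of the plug-in and existence of the
minimizer. Consistency of the minimizer is not assumed: it follows from coercivity and bicontinuity.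
-/

/-! ### Central limit theorem for the noisy histogram, by characteristic functions. -/

/-- The covariance matrix `Diag q - q qᵀ + a I` of one noisy categorical trial. -/
def covar {d : ℕ} (q : Vec d) (a : ℝ) : Matrix (Fin d) (Fin d) ℝ :=
  Matrix.diagonal q.ofLp - Matrix.vecMulVec q.ofLp q.ofLp + a • 1

lemma isProbabilityMeasure_categorical {d : ℕ} {q : Vec d} (h0 : ∀ i, 0 ≤ q i)
    (h1 : ∑ i, q i = 1) : IsProbabilityMeasure (categorical q) := by
  constructor
  simp only [categorical, Measure.coe_finsetSum, Finset.sum_apply, Measure.smul_apply,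
    measure_univ, smul_eq_mul, mul_one]
  rw [← ENNReal.ofReal_sum_of_nonneg fun i _ => h0 i, h1, ENNReal.ofReal_one]

lemma integral_categorical {d : ℕ} {q : Vec d} (h0 : ∀ i, 0 ≤ q i) (f : Fin d → ℂ) :
    ∫ i, f i ∂categorical q = ∑ i, (q i : ℂ) * f i := by
  rw [categorical, integral_finsetSum_measure]
  · simp [integral_smul_measure, h0]
  · intro i _
    exact (integrable_dirac (by simp)).smul_measure ENNReal.ofReal_ne_top

/-- A histogram is a sum of `n` independent one-hot vectors. -/
lemma charFun_multinomial {d : ℕ} {q : Vec d} (h0 : ∀ i, 0 ≤ q i) (h1 : ∑ i, q i = 1) (n : ℕ)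
    (t : Vec d) :
    charFun (multinomial n q) t = (∑ i, (q i : ℂ) * Complex.exp (t i * Complex.I)) ^ n := by
  have := isProbabilityMeasure_categorical h0 h1
  have hsum : (histogram : (Fin n → Fin d) → Vec d)
      = (fun x : Fin n → Vec d => ∑ j, x j) ∘ fun s j => EuclideanSpace.single (s j) (1 : ℝ) := by
    ext s i
    simp only [histogram, Function.comp_apply, WithLp.ofLp_sum, Finset.sum_apply, PiLp.single_apply,
      Finset.sum_boole]
    simp_rw [eq_comm]
  have hs : Measurable fun i : Fin d => EuclideanSpace.single i (1 : ℝ) :=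
    measurable_of_finite _
  have : IsProbabilityMeasure
      ((categorical q).map fun i : Fin d => EuclideanSpace.single i (1 : ℝ)) :=
    Measure.isProbabilityMeasure_map hs.aemeasurable
  rw [multinomial, hsum, ← Measure.map_map (by fun_prop) (measurable_of_finite _),
    Measure.pi_map_pi (μ := fun _ : Fin n => categorical q)
      (f := fun _ i => EuclideanSpace.single i (1 : ℝ)) (fun _ => hs.aemeasurable),
    charFun_map_sum_pi_eq_prod]
  simp only [Finset.prod_const, Finset.card_univ, Fintype.card_fin, Pi.pow_apply]
  rw [charFun_apply, integral_map hs.aemeasurable (by fun_prop), integral_categorical h0]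
  simp [EuclideanSpace.inner_single_left]

/-- Second-order Taylor expansion of each exponential; the mean-zero condition cancels the linear
terms. -/
lemma isLittleO_weighted_exp_sub {d : ℕ} {q a : Fin d → ℝ} (h1 : ∑ i, q i = 1)
    (ha : ∑ i, q i * a i = 0) :
    (fun u : ℝ => ∑ i, (q i : ℂ) * Complex.exp (a i * u * Complex.I)
        - (1 + ((-(∑ i, q i * a i ^ 2) / 2 * u ^ 2 : ℝ) : ℂ))) =o[𝓝 0] fun u : ℝ => u ^ 2 := by
  have key (i : Fin d) : (fun u : ℝ => (q i : ℂ) * (Complex.exp (a i * u * Complex.I)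
      - (1 + a i * u * Complex.I + (a i * u * Complex.I) ^ 2 / 2))) =o[𝓝 0] fun u : ℝ => u ^ 2 := by
    refine Asymptotics.IsLittleO.const_mul_left ?_ _
    have ht : Tendsto (fun u : ℝ => (a i * u * Complex.I : ℂ)) (𝓝 0) (𝓝 0) := by
      have : Continuous (fun u : ℝ => (a i * u * Complex.I : ℂ)) := by fun_prop
      simpa using this.tendsto 0
    have h := (Complex.exp_sub_sum_range_isBigO_pow 3).comp_tendsto ht
    have h' : (fun u : ℝ => (a i * u * Complex.I : ℂ) ^ 3) =O[𝓝 0] fun u : ℝ => u ^ 3 := by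
      refine Asymptotics.IsBigO.of_bound (|a i| ^ 3) (Eventually.of_forall fun u => ?_)
      simp [mul_pow]
    refine ((h.trans h').trans_isLittleO ?_).congr_left ?_
    · exact Asymptotics.isLittleO_pow_pow (by norm_num)
    · intro u
      simp [Finset.sum_range_succ, Nat.factorial]
  refine (Asymptotics.IsLittleO.sum fun i (_ : i ∈ Finset.univ) => key i).congr_left fun u => ?_
  have e1 : ∑ i, (q i : ℂ) = 1 := by exact_mod_cast h1
  have e2 : ∑ i, (q i : ℂ) * a i = 0 := by exact_mod_cast ha
  have e3 : ∑ i, (q i : ℂ) * (a i * u * Complex.I) = 0 := by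
    simp_rw [← mul_assoc, ← Finset.sum_mul, e2, zero_mul]
  have e4 : ∑ i, (q i : ℂ) * ((a i * u * Complex.I) ^ 2 / 2)
      = ((-(∑ i, q i * a i ^ 2) / 2 * u ^ 2 : ℝ) : ℂ) := by
    push_cast
    rw [← Finset.sum_neg_distrib, Finset.sum_div, Finset.sum_mul]
    refine Finset.sum_congr rfl fun i _ => ?_
    rw [mul_pow, mul_pow, Complex.I_sq]; ring
  simp only [Finset.sum_apply, mul_sub, mul_add, Finset.sum_sub_distrib, Finset.sum_add_distrib,
    mul_one, e1, e3, e4, add_zero]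

lemma tendsto_weighted_exp_pow {d : ℕ} {q a : Fin d → ℝ} (h1 : ∑ i, q i = 1)
    (ha : ∑ i, q i * a i = 0) :
    Tendsto (fun n : ℕ => (∑ i, (q i : ℂ) * Complex.exp (a i * ((√n)⁻¹ : ℝ) * Complex.I)) ^ n)
      atTop (𝓝 (Complex.exp ((-(∑ i, q i * a i ^ 2) / 2 : ℝ)))) := by
  apply Complex.tendsto_pow_exp_of_isLittleO_sub_add_div
  have ht : Tendsto (fun n : ℕ => (√(n : ℝ))⁻¹) atTop (𝓝 0) :=
    tendsto_inv_atTop_zero.comp (Real.tendsto_sqrt_atTop.comp tendsto_natCast_atTop_atTop)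
  have h := (isLittleO_weighted_exp_sub h1 ha).comp_tendsto ht
  rw [← Asymptotics.isLittleO_norm_right] at h ⊢
  refine h.congr (fun n => ?_) (fun n => ?_)
  · simp only [Function.comp_apply, inv_pow, Nat.cast_nonneg, Real.sq_sqrt]
    push_cast
    simp [div_eq_mul_inv]
  · simp

/-- The variance of `t` under `q` plus a noise term: this makes nonnegativity visible and matches
the exponent produced by the Taylor expansion. -/
lemma dotProduct_covar_mulVec {d : ℕ} {q : Vec d} (h1 : ∑ i, q i = 1) (a : ℝ) (t : Vec d) :
    t.ofLp ⬝ᵥ (covar q a).mulVec t.ofLp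
      = ∑ i, q i * (t i - ∑ j, q j * t j) ^ 2 + a * ‖t‖ ^ 2 := by
  set m := ∑ j, q j * t j with hm
  have e : ∑ i, q i * (t i - m) ^ 2 = ∑ i, q i * t i ^ 2 - m ^ 2 := by
    have : ∀ i, q i * (t i - m) ^ 2 = q i * t i ^ 2 - 2 * m * (q i * t i) + m ^ 2 * q i :=
      fun i => by ring
    simp only [this, Finset.sum_add_distrib, Finset.sum_sub_distrib, ← Finset.mul_sum, h1, ← hm]
    ring
  rw [e, covar, Matrix.add_mulVec, Matrix.sub_mulVec, dotProduct_add, dotProduct_sub,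
    Matrix.vecMulVec_mulVec, Matrix.smul_mulVec, Matrix.one_mulVec, EuclideanSpace.real_norm_sq_eq]
  simp only [dotProduct, Matrix.mulVec_diagonal, Pi.smul_apply, smul_eq_mul]
  congr 1
  · congr 1
    · exact Finset.sum_congr rfl fun i _ => by ring
    · simp only [MulOpposite.smul_eq_mul_unop, MulOpposite.unop_op]
      rw [sq, ← hm, hm, Finset.sum_mul]
      exact Finset.sum_congr rfl fun i _ => by ring
  · rw [Finset.mul_sum]
    exact Finset.sum_congr rfl fun i _ => by ring

lemma tendsto_charFun_scaled {d : ℕ} {Ω : Type*} [MeasurableSpace Ω] {P : Measure Ω}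
    [IsProbabilityMeasure P] {q : Vec d} (h0 : ∀ i, 0 ≤ q i) (h1 : ∑ i, q i = 1)
    {ρ : ℕ → ℝ} (hρ : ∀ n, 0 < ρ n) {X Z : ℕ → Ω → Vec d}
    (hX : ∀ n, HasLaw (X n) (multinomial n q) P)
    (hZ : ∀ n, HasLaw (Z n) (multivariateGaussian 0 ((1 / ρ n) • 1)) P)
    (hXZ : ∀ n, IndepFun (X n) (Z n) P) {a : ℝ}
    (ha : Tendsto (fun n : ℕ => 1 / ((n : ℝ) * ρ n)) atTop (𝓝 a)) (t : Vec d) :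
    Tendsto (fun n : ℕ => charFun
        (P.map fun ω => √(n : ℝ) • ((n : ℝ)⁻¹ • (X n ω + Z n ω) - q)) t) atTop
      (𝓝 (Complex.exp ((-(t.ofLp ⬝ᵥ (covar q a).mulVec t.ofLp) / 2 : ℝ)))) := by
  -- Coordinates of `t` centred under `q`, so that the mean-zero limit applies.
  set b : Fin d → ℝ := fun i => t i - ∑ j, q j * t j with hb
  have hb0 : ∑ i, q i * b i = 0 := by
    simp only [hb, mul_sub, Finset.sum_sub_distrib, ← Finset.sum_mul, h1, one_mul, sub_self]
  have hlim := (tendsto_weighted_exp_pow h1 hb0).mul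
    ((Complex.continuous_exp.comp Complex.continuous_ofReal).tendsto _ |>.comp
      ((ha.mul_const (-‖t‖ ^ 2 / 2))))
  rw [Function.comp_apply, ← Complex.exp_add, ← Complex.ofReal_add] at hlim
  rw [dotProduct_covar_mulVec h1]
  have e : -(∑ i, q i * b i ^ 2) / 2 + a * (-‖t‖ ^ 2 / 2)
      = -(∑ i, q i * (t i - ∑ j, q j * t j) ^ 2 + a * ‖t‖ ^ 2) / 2 := by simp only [hb]; ring
  rw [e] at hlim
  refine hlim.congr' ?_
  filter_upwards [eventually_gt_atTop 0] with n hn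
  have hn' : (0 : ℝ) < n := by exact_mod_cast hn
  have hsq : √(n : ℝ) * (n : ℝ)⁻¹ = (√(n : ℝ))⁻¹ := by
    rw [← div_eq_mul_inv, Real.sqrt_div_self]
  have hfun : (fun ω => √(n : ℝ) • ((n : ℝ)⁻¹ • (X n ω + Z n ω) - q))
      = fun ω => (√(n : ℝ))⁻¹ • (X n ω + Z n ω) + -(√(n : ℝ) • q) := by
    ext1 ω; rw [smul_sub, smul_smul, hsq, sub_eq_add_neg]
  have hm : AEMeasurable (fun ω => X n ω + Z n ω) P := (hX n).aemeasurable.add (hZ n).aemeasurable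
  have hcomp : P.map (fun ω => (√(n : ℝ))⁻¹ • (X n ω + Z n ω) + -(√(n : ℝ) • q))
      = (P.map (fun ω => (√(n : ℝ))⁻¹ • (X n ω + Z n ω))).map (· + -(√(n : ℝ) • q)) := by
    rw [AEMeasurable.map_map_of_aemeasurable (by fun_prop) (by fun_prop)]; rfl
  rw [hfun, hcomp, charFun_map_add_const, charFun_map_smul_comp hm,
    (hXZ n).charFun_map_fun_add_eq_mul (hX n).aemeasurable (hZ n).aemeasurable,
    (hX n).map_eq, (hZ n).map_eq, Pi.mul_apply, charFun_multinomial h0 h1,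
    charFun_multivariateGaussian
      (Matrix.PosSemidef.one.smul (by have := hρ n; positivity))]
  have hq : (inner ℝ (-(√(n : ℝ) • q)) t : ℝ) = n * (-((√(n : ℝ))⁻¹ * ∑ j, q j * t j)) := by
    have : (inner ℝ q t : ℝ) = ∑ j, q j * t j := by
      simp [PiLp.inner_apply, mul_comm]
    rw [inner_neg_left, real_inner_smul_left, this]
    have : √(n : ℝ) = n * (√(n : ℝ))⁻¹ := by rw [← hsq]; field_simp
    rw [mul_neg, ← mul_assoc, ← this]
  -- The phase due to the shift by `-√n q` is an `n`-th power, so it merges with the multinomial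
  -- factor and centres `t`.
  have hexp : Complex.exp ((inner ℝ (-(√(n : ℝ) • q)) t : ℝ) * Complex.I)
      = Complex.exp ((-((√(n : ℝ))⁻¹ * ∑ j, q j * t j) : ℝ) * Complex.I) ^ n := by
    rw [← Complex.exp_nat_mul, hq]; push_cast; ring_nf
  rw [hexp, mul_right_comm, ← mul_pow, Finset.sum_mul]
  congr 1
  · congr 1
    refine Finset.sum_congr rfl fun i _ => ?_
    rw [mul_assoc (q i : ℂ) (Complex.exp _) (Complex.exp _), ← Complex.exp_add]
    congr 2
    simp only [hb, PiLp.smul_apply, smul_eq_mul]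
    push_cast; ring
  · simp only [Function.comp_apply, inner_zero_right, Complex.ofReal_zero, zero_mul, zero_sub]
    congr 1
    have hc : ((√(n : ℝ))⁻¹ • t).ofLp ⬝ᵥ ((1 / ρ n) • (1 : Matrix (Fin d) (Fin d) ℝ)).mulVec
        ((√(n : ℝ))⁻¹ • t).ofLp = 1 / (n * ρ n) * ‖t‖ ^ 2 := by
      rw [Matrix.smul_mulVec, Matrix.one_mulVec, WithLp.ofLp_smul, smul_dotProduct,
        dotProduct_smul, dotProduct_smul, EuclideanSpace.real_norm_sq_eq]
      have : t.ofLp ⬝ᵥ t.ofLp = ∑ i, t i ^ 2 := Finset.sum_congr rfl fun i _ => (sq _).symm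
      rw [this]
      simp only [smul_eq_mul]
      have h2 : (√(n : ℝ))⁻¹ * (√(n : ℝ))⁻¹ = (n : ℝ)⁻¹ := by
        rw [← mul_inv, Real.mul_self_sqrt hn'.le]
      have h3 := (hρ n).ne'
      calc _ = ((√(n : ℝ))⁻¹ * (√(n : ℝ))⁻¹) * (1 / ρ n) * ∑ i, t i ^ 2 := by ring
        _ = _ := by rw [h2]; field_simp
    rw [hc]; push_cast; ring

/-! ### Minimizing a convergent quadratic form over a smooth model. -/

/-- The quadratic form `x ↦ xᵀ S x`. -/
def quad {d : ℕ} (S : Matrix (Fin d) (Fin d) ℝ) (x : Vec d) : ℝ :=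
  x.ofLp ⬝ᵥ S.mulVec x.ofLp

lemma continuous_quad {d : ℕ} :
    Continuous fun z : Matrix (Fin d) (Fin d) ℝ × Vec d => quad z.1 z.2 := by
  unfold quad
  exact Continuous.dotProduct (by fun_prop) (Continuous.matrix_mulVec (by fun_prop) (by fun_prop))

lemma quad_smul {d : ℕ} (S : Matrix (Fin d) (Fin d) ℝ) (c : ℝ) (x : Vec d) :
    quad S (c • x) = c ^ 2 * quad S x := by
  simp only [quad, WithLp.ofLp_smul, Matrix.mulVec_smul, dotProduct_smul, smul_dotProduct,
    smul_eq_mul]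
  ring

/-- Compactness of the unit sphere gives a lower bound for `S₀`; half of it survives small
perturbations, and homogeneity extends it to all vectors. -/
lemma exists_eventually_mul_norm_sq_le_quad {d : ℕ} {S₀ : Matrix (Fin d) (Fin d) ℝ}
    (hpos : ∀ x : Vec d, x ≠ 0 → 0 < quad S₀ x) :
    ∃ c > 0, ∀ᶠ S in 𝓝 S₀, ∀ x : Vec d, c * ‖x‖ ^ 2 ≤ quad S x := by
  have hK := isCompact_sphere (0 : Vec d) 1
  obtain ⟨c, hc, hmin⟩ := hK.exists_forall_le' (f := fun x => quad S₀ x) (a := 0)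
    (continuous_quad.comp (by fun_prop : Continuous fun x : Vec d => (S₀, x))).continuousOn
    (fun x hx => hpos x (by rintro rfl; simp at hx))
  refine ⟨c / 2, by positivity, ?_⟩
  have h := hK.eventually_forall_of_forall_eventually (x₀ := S₀)
    (P := fun S x => c / 2 < quad S x) (fun x hx => by
      refine continuous_quad.continuousAt.eventually (lt_mem_nhds ?_)
      have := hmin x hx
      linarith)
  filter_upwards [h] with S hS x
  rcases eq_or_ne x 0 with rfl | hx
  · simp [quad]
  · have hn : 0 < ‖x‖ := norm_pos_iff.2 hx
    have h1 := hS (‖x‖⁻¹ • x) (by simp [norm_smul, hn.ne'])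
    rw [quad_smul] at h1
    have h2 : quad S x = ‖x‖ ^ 2 * ((‖x‖⁻¹) ^ 2 * quad S x) := by field_simp
    rw [h2, mul_comm]
    gcongr

/-- Replaces the extraction of convergent subsequences. -/
lemma Ultrafilter.exists_tendsto_of_norm_le {ι E : Type*} [SeminormedAddCommGroup E] [ProperSpace E]
    (U : Ultrafilter ι) {f : ι → E} {K : ℝ} (hf : ∀ᶠ i in U, ‖f i‖ ≤ K) :
    ∃ x, Tendsto f U (𝓝 x) := by
  obtain ⟨x, -, hx⟩ := (isCompact_closedBall (0 : E) K).ultrafilter_le_nhds (U.map f)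
    (by
      rw [le_principal_iff]
      exact mem_of_superset hf fun i hi => mem_closedBall_zero_iff.2 hi)
  exact ⟨x, hx⟩

/-- The sequential hypothesis passes to arbitrary filters because `comap A (𝓝 (A θ)) ⊓ 𝓟 Θ` is
countably generated. -/
lemma BicontinuousOn.tendsto {d k : ℕ} {A : Vec k → Vec d} {Θ : Set (Vec k)}
    (hA : BicontinuousOn A Θ) {θ : Vec k} (hθ : θ ∈ Θ) {ι : Type*} {l : Filter ι} {u : ι → Vec k}
    (hu : ∀ᶠ i in l, u i ∈ Θ) (h : Tendsto (fun i => A (u i)) l (𝓝 (A θ))) :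
    Tendsto u l (𝓝 θ) := by
  classical
  suffices H : Tendsto id (comap A (𝓝 (A θ)) ⊓ 𝓟 Θ) (𝓝 θ) from
    H.comp (tendsto_inf.2 ⟨tendsto_comap_iff.2 h, tendsto_principal.2 hu⟩)
  refine tendsto_of_seq_tendsto fun v hv => ?_
  obtain ⟨hv1, hv2⟩ := tendsto_inf.1 hv
  rw [tendsto_comap_iff] at hv1
  rw [tendsto_principal] at hv2
  -- The sequence is only eventually in `Θ`; stray terms are replaced by `θ`.
  have hev : (fun j => if v j ∈ Θ then v j else θ) =ᶠ[atTop] v := by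
    filter_upwards [hv2] with j hj using if_pos hj
  refine Tendsto.congr' hev ((hA _ (fun j => ?_) θ hθ).2 ?_)
  · split_ifs <;> assumption
  · refine hv1.congr' ?_
    filter_upwards [hev] with j hj
    rw [hj]; rfl

lemma HasFDerivAt.isBigO_sub_of_antilipschitzWith {E F : Type*} [NormedAddCommGroup E]
    [NormedSpace ℝ E] [NormedAddCommGroup F] [NormedSpace ℝ F] {f : E → F} {f' : E →L[ℝ] F} {x : E}
    (hf : HasFDerivAt f f' x) {C : NNReal} (hf' : AntilipschitzWith C f') :
    (fun z => z - x) =O[𝓝 x] fun z => f z - f x := by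
  have hA : (fun z => z - x) =O[𝓝 x] fun z => f' (z - x) :=
    Asymptotics.isBigO_iff.2 ⟨C, Eventually.of_forall fun z => by
      simpa [-map_sub] using hf'.le_mul_dist (z - x) 0⟩
  have hequiv : Asymptotics.IsEquivalent (𝓝 x) (fun z => f z - f x) fun z => f' (z - x) :=
    hf.isLittleO.trans_isBigO hA
  exact hA.trans hequiv.isBigO_symm

/-- Along any ultrafilter `w` has a limit `x`. Comparison with `θ₀` bounds the rescaled displacement
of `p`; bicontinuity and injectivity of `J` then bound that of the parameter, which has a limit `h`.
Comparison with nearby parameters shows that `h` solves the linear problem at `x`, whose value is `g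
x`. -/
theorem tendsto_quad_minimizer_sub {d k : ℕ} {ι : Type*} {l : Filter ι}
    {Θ : Set (Vec k)} (hΘ : IsOpen Θ) {p : Vec k → Vec d} (hbic : BicontinuousOn p Θ)
    {θ₀ : Vec k} (hθ₀ : θ₀ ∈ Θ) {J : Vec k →L[ℝ] Vec d} (hp : HasFDerivAt p J θ₀)
    (hJ : Function.Injective J) {N : ι → ℝ} (hN : Tendsto N l atTop)
    {S : ι → Matrix (Fin d) (Fin d) ℝ} {S₀ : Matrix (Fin d) (Fin d) ℝ} (hS : Tendsto S l (𝓝 S₀))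
    (hpos : ∀ x : Vec d, x ≠ 0 → 0 < quad S₀ x) {C : Set (Vec d)} (hC : IsClosed C)
    {w : ι → Vec d} {K : ℝ} (hw : ∀ᶠ i in l, ‖w i‖ ≤ K) (hwC : ∀ᶠ i in l, w i ∈ C)
    {est : ι → Vec k} (hest : ∀ᶠ i in l, est i ∈ Θ)
    (hmin : ∀ᶠ i in l, ∀ θ ∈ Θ, quad (S i) (w i - N i • (p (est i) - p θ₀))
      ≤ quad (S i) (w i - N i • (p θ - p θ₀)))
    {g : Vec d → ℝ} (hg : Continuous g)
    (hgC : ∀ x ∈ C, ∀ h, (∀ h', quad S₀ (x - J h) ≤ quad S₀ (x - J h')) →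
      quad S₀ (x - J h) = g x) :
    Tendsto (fun i => quad (S i) (w i - N i • (p (est i) - p θ₀)) - g (w i)) l (𝓝 0) := by
  rw [tendsto_iff_ultrafilter]
  intro U hU
  replace hN := hN.mono_left hU
  replace hS := hS.mono_left hU
  replace hw := hw.filter_mono hU
  replace hwC := hwC.filter_mono hU
  replace hest := hest.filter_mono hU
  replace hmin := hmin.filter_mono hU
  obtain ⟨x, hx⟩ := U.exists_tendsto_of_norm_le hw
  have hxC : x ∈ C := hC.mem_of_tendsto hx hwC
  have hquad {v : ι → Vec d} {y : Vec d} (hv : Tendsto v U (𝓝 y)) :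
      Tendsto (fun i => quad (S i) (v i)) U (𝓝 (quad S₀ y)) :=
    (continuous_quad.tendsto (S₀, y)).comp (hS.prodMk_nhds hv)
  obtain ⟨c, hc, hcoer⟩ := exists_eventually_mul_norm_sq_le_quad hpos
  -- Coercivity bounds the residual by the value at the competitor `θ₀`, which is eventually at most
  -- `quad S₀ x + 1`.
  have hVbd : ∀ᶠ i in U, ‖N i • (p (est i) - p θ₀)‖
      ≤ √((quad S₀ x + 1) / c) + K := by
    filter_upwards [hS.eventually hcoer, hmin, hw,
      (hquad hx).eventually (ge_mem_nhds (lt_add_one (quad S₀ x)))] with i h1 h2 h3 h4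
    have h5 := (h1 _).trans (h2 θ₀ hθ₀)
    rw [sub_self, smul_zero, sub_zero] at h5
    have h6 : ‖w i - N i • (p (est i) - p θ₀)‖ ≤ √((quad S₀ x + 1) / c) := by
      apply Real.le_sqrt_of_sq_le
      rw [le_div_iff₀ hc, mul_comm]
      exact h5.trans h4
    calc ‖N i • (p (est i) - p θ₀)‖ = ‖w i - (w i - N i • (p (est i) - p θ₀))‖ := by
          rw [sub_sub_cancel]
      _ ≤ ‖w i‖ + ‖w i - N i • (p (est i) - p θ₀)‖ := norm_sub_le _ _
      _ ≤ _ := by linarith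
  have hNinv : Tendsto (fun i => (N i)⁻¹) U (𝓝 0) := tendsto_inv_atTop_zero.comp hN
  have hNpos : ∀ᶠ i in U, 0 < N i := hN.eventually_gt_atTop 0
  obtain ⟨V, hV⟩ := U.exists_tendsto_of_norm_le hVbd
  have hpest : Tendsto (fun i => p (est i)) U (𝓝 (p θ₀)) := by
    have h := (hNinv.smul hV).add_const (p θ₀)
    rw [zero_smul, zero_add] at h
    refine h.congr' ?_
    filter_upwards [hNpos] with i hi
    rw [smul_smul, inv_mul_cancel₀ hi.ne', one_smul, sub_add_cancel]
  have hestlim : Tendsto est U (𝓝 θ₀) := hbic.tendsto hθ₀ hest hpest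
  obtain ⟨κ, -, hκ⟩ := J.toLinearMap.exists_antilipschitzWith (LinearMap.ker_eq_bot.2 hJ)
  obtain ⟨D, hD⟩ := (hp.isBigO_sub_of_antilipschitzWith hκ).bound
  have hhbd : ∀ᶠ i in U, ‖N i • (est i - θ₀)‖ ≤ |D| * (√((quad S₀ x + 1) / c) + K) := by
    filter_upwards [hVbd, hestlim.eventually hD] with i h1 h2
    calc ‖N i • (est i - θ₀)‖ = ‖N i‖ * ‖est i - θ₀‖ := norm_smul _ _
      _ ≤ ‖N i‖ * (|D| * ‖p (est i) - p θ₀‖) := by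
          gcongr
          exact h2.trans (by gcongr; exact le_abs_self D)
      _ = |D| * ‖N i • (p (est i) - p θ₀)‖ := by rw [norm_smul]; ring
      _ ≤ _ := by gcongr
  obtain ⟨h, hh⟩ := U.exists_tendsto_of_norm_le hhbd
  have hNnorm : Tendsto (fun i => ‖N i‖) U atTop := tendsto_norm_atTop_atTop.comp hN
  have hVJ : Tendsto (fun i => N i • (p (est i) - p θ₀)) U (𝓝 (J h)) := by
    simpa using hp.hasFDerivWithinAt.lim (s := Set.univ) (c := N) (d := fun i => est i - θ₀)
      (tendsto_sub_nhds_zero_iff.2 hestlim) (by simp) hh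
  have hT := hquad (hx.sub hVJ)
  have hle (h' : Vec k) : quad S₀ (x - J h) ≤ quad S₀ (x - J h') := by
    -- The competitor is `θ₀ + (N i)⁻¹ • h'`, which lies in `Θ` eventually since `Θ` is open.
    have h1 := hp.lim h' hNnorm
    refine le_of_tendsto_of_tendsto hT (hquad (hx.sub h1)) ?_
    have h2 : Tendsto (fun i => θ₀ + (N i)⁻¹ • h') U (𝓝 θ₀) := by
      simpa using (hNinv.smul_const h').const_add θ₀
    filter_upwards [hmin, h2.eventually (hΘ.mem_nhds hθ₀)] with i h3 h4 using h3 _ h4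
  have := hT.sub ((hg.tendsto x).comp hx)
  rwa [hgC x hxC h hle, sub_self] at this

/-! ### Generalized least squares and the dimension of the residual space. -/

lemma quad_eq_inner {d : ℕ} (S : Matrix (Fin d) (Fin d) ℝ) (x : Vec d) :
    quad S x = inner ℝ x (Matrix.toEuclideanCLM (𝕜 := ℝ) S x) :=
  (Matrix.inner_toEuclideanCLM S x x).symm

/-- The dimension of the line is left as a `finrank` so that `v = 0` is allowed. -/
lemma finrank_orthogonal_range_sup_span {V W : Type*} [NormedAddCommGroup V]
    [InnerProductSpace ℝ V] [FiniteDimensional ℝ V] [AddCommGroup W] [Module ℝ W]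
    {T : W →ₗ[ℝ] V} (hT : Function.Injective T) {v : V} (hv : ∀ x, inner ℝ v (T x) = 0) :
    Module.finrank ℝ (LinearMap.range T ⊔ ℝ ∙ v : Submodule ℝ V)ᗮ
      = Module.finrank ℝ V - Module.finrank ℝ W - Module.finrank ℝ (ℝ ∙ v) := by
  have hdisj : LinearMap.range T ⊓ (ℝ ∙ v) = ⊥ := by
    rw [Submodule.eq_bot_iff]
    rintro y ⟨⟨x, rfl⟩, hy⟩
    obtain ⟨c, hc⟩ := Submodule.mem_span_singleton.1 hy
    rw [← inner_self_eq_zero (𝕜 := ℝ)]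
    nth_rewrite 1 [← hc]
    rw [real_inner_smul_left, hv, mul_zero]
  have h1 := Submodule.finrank_sup_add_finrank_inf_eq (LinearMap.range T) (ℝ ∙ v)
  rw [hdisj, finrank_bot, LinearMap.finrank_range_of_inj hT] at h1
  have h2 := (LinearMap.range T ⊔ ℝ ∙ v).finrank_add_finrank_orthogonal
  omega

lemma finrank_span_singleton_map {V W : Type*} [AddCommGroup V] [Module ℝ V] [AddCommGroup W]
    [Module ℝ W] {T : V →ₗ[ℝ] W} (hT : Function.Injective T) (v : V) :
    Module.finrank ℝ (ℝ ∙ T v) = Module.finrank ℝ (ℝ ∙ v) := by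
  rcases eq_or_ne v 0 with rfl | hv
  · rw [map_zero, Submodule.span_zero_singleton, Submodule.span_zero_singleton, finrank_bot,
      finrank_bot]
  · rw [finrank_span_singleton hv, finrank_span_singleton ((map_ne_zero_iff T hT).2 hv)]

open scoped MatrixOrder in
/-- The generalized least squares residual of a linear model with covariance matrix `G`: the
minimum of `(w - J h)ᵀ G⁻¹ (w - J h)` over `h` is `‖B w‖²` with `B G Bᵀ = I`. -/
theorem exists_residual_map {d k : ℕ} {G : Matrix (Fin d) (Fin d) ℝ} (hG : G.PosDef)
    {e : Vec d} {c : ℝ} (hc : c ≠ 0) (hGe : Matrix.toEuclideanCLM (𝕜 := ℝ) G e = c • e)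
    {J : Vec k →L[ℝ] Vec d} (hJ : Function.Injective J) (hJe : ∀ h, inner ℝ e (J h) = 0) :
    ∃ (B : Vec d →L[ℝ] Vec (d - k - Module.finrank ℝ (ℝ ∙ e)))
      (D : Vec (d - k - Module.finrank ℝ (ℝ ∙ e)) → Vec d),
      B e = 0 ∧ (∀ w s, inner ℝ (B w) s = inner ℝ w (D s)) ∧ (∀ s, quad G (D s) = ‖s‖ ^ 2) ∧
      ∀ w, inner ℝ e w = 0 → ∀ h, (∀ h', quad G⁻¹ (w - J h) ≤ quad G⁻¹ (w - J h')) →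
        quad G⁻¹ (w - J h) = ‖B w‖ ^ 2 := by
  -- Whitening: a factorization `G⁻¹ = A* A` turns the form into `‖A x‖²`.
  obtain ⟨R, hR⟩ := CStarAlgebra.nonneg_iff_eq_star_mul_self.mp hG.inv.posSemidef.nonneg
  set T := Matrix.toEuclideanCLM (n := Fin d) (𝕜 := ℝ)
  set A : Vec d →L[ℝ] Vec d := T R with hA
  have hdet : IsUnit G.det := (Matrix.isUnit_iff_isUnit_det G).1 hG.isUnit
  have hSA : T G⁻¹ = (ContinuousLinearMap.adjoint A) * A := by
    rw [hR, map_mul, map_star]; rfl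
  have hAG (x : Vec d) : T G (ContinuousLinearMap.adjoint A (A x)) = x := by
    have : T G * T G⁻¹ = 1 := by rw [← map_mul, Matrix.mul_nonsing_inv _ hdet, map_one]
    rw [hSA] at this
    exact congr($this x)
  have hGA (x : Vec d) : ContinuousLinearMap.adjoint A (A (T G x)) = x := by
    have : T G⁻¹ * T G = 1 := by rw [← map_mul, Matrix.nonsing_inv_mul _ hdet, map_one]
    rw [hSA] at this
    exact congr($this x)
  have hAinj : Function.Injective A := fun x y hxy => by rw [← hAG x, hxy, hAG]
  have hAsurj : Function.Surjective A := LinearMap.surjective_of_injective (f := A.toLinearMap) hAinj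
  have hquad (x : Vec d) : quad G⁻¹ x = ‖A x‖ ^ 2 := by
    rw [quad_eq_inner]
    change inner ℝ x (T G⁻¹ x) = _
    rw [hSA, mul_apply_eq_comp, ContinuousLinearMap.adjoint_inner_right,
      real_inner_self_eq_norm_sq]
  have hquadG (y : Vec d) : quad G (ContinuousLinearMap.adjoint A y) = ‖y‖ ^ 2 := by
    obtain ⟨x, rfl⟩ := hAsurj y
    rw [quad_eq_inner]
    change inner ℝ _ (T G _) = _
    rw [hAG, ContinuousLinearMap.adjoint_inner_left, real_inner_self_eq_norm_sq]
  -- Since `e` is an eigenvector of `G`, `A* A e = c⁻¹ e`, so orthogonality to `e` is preserved by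
  -- whitening.
  have hAe (x : Vec d) (hx : inner ℝ e x = 0) : inner ℝ (A e) (A x) = 0 := by
    have h1 : ContinuousLinearMap.adjoint A (A e) = c⁻¹ • e := by
      have h2 := hGA e
      rw [hGe, map_smul, map_smul] at h2
      rw [← h2, smul_smul, inv_mul_cancel₀ hc, one_smul, h2]
    rw [← ContinuousLinearMap.adjoint_inner_left, h1, real_inner_smul_left, hx, mul_zero]
  set L : Submodule ℝ (Vec d) := LinearMap.range (A ∘L J).toLinearMap ⊔ ℝ ∙ A e with hL
  have hfin : Module.finrank ℝ Lᗮ = d - k - Module.finrank ℝ (ℝ ∙ e) := by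
    have := finrank_orthogonal_range_sup_span (T := (A ∘L J).toLinearMap)
      (hAinj.comp hJ) (v := A e) (fun x => hAe _ (hJe x))
    rw [hL, this, finrank_euclideanSpace_fin, finrank_euclideanSpace_fin,
      ← finrank_span_singleton_map (T := A.toLinearMap) hAinj e]
    rfl
  have hLorth (y : Vec d) : y ∈ Lᗮ ↔ (∀ h, inner ℝ (A (J h)) y = 0) ∧ inner ℝ (A e) y = 0 := by
    rw [hL, ← Submodule.inf_orthogonal, Submodule.mem_inf,
      Submodule.mem_orthogonal_singleton_iff_inner_right,
      Submodule.mem_orthogonal]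
    simp
  let ψ := ((stdOrthonormalBasis ℝ Lᗮ).reindex (finCongr hfin)).repr
  -- Whiten, project away from the tangent directions and `e`, and read off orthonormal coordinates.
  let B : Vec d →L[ℝ] Vec (d - k - Module.finrank ℝ (ℝ ∙ e)) :=
    ψ.toContinuousLinearEquiv.toContinuousLinearMap ∘L Lᗮ.orthogonalProjectionOnto ∘L A
  have hBL (x : Vec d) (hx : A x ∈ L) : B x = 0 := by
    change ψ (Lᗮ.orthogonalProjectionOnto (A x)) = 0
    rw [Submodule.orthogonalProjectionOnto_apply_of_mem_orthogonal
      (Submodule.le_orthogonal_orthogonal L hx), map_zero]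
  have hBJ (w : Vec d) (h : Vec k) : B (w - J h) = B w := by
    rw [map_sub, hBL (J h) (Submodule.mem_sup_left ⟨h, rfl⟩), sub_zero]
  have hBnorm (x : Vec d) : ‖B x‖ = ‖Lᗮ.orthogonalProjectionOnto (A x)‖ := ψ.norm_map _
  refine ⟨B, fun s => ContinuousLinearMap.adjoint A (ψ.symm s), ?_, ?_, ?_, ?_⟩
  · exact hBL e (Submodule.mem_sup_right (Submodule.mem_span_singleton_self _))
  · intro w s
    change inner ℝ (ψ (Lᗮ.orthogonalProjectionOnto (A w))) s = _
    rw [ContinuousLinearMap.adjoint_inner_right,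
      ← Submodule.inner_orthogonalProjectionOnto_eq_of_mem_right, ← ψ.inner_map_map,
      ψ.apply_symm_apply]
  · intro s
    rw [hquadG, ← Submodule.coe_norm, ψ.symm.norm_map]
  · intro w hw h hmin
    simp only [hquad] at hmin ⊢
    obtain ⟨y, ⟨h₀, rfl⟩, z, hz, hyz⟩ := Submodule.exists_add_mem_mem_orthogonal
      (K := LinearMap.range (A ∘L J).toLinearMap) (A w)
    have hz' : A (w - J h₀) = z := by
      rw [map_sub, hyz]; simp
    have hzL : A (w - J h₀) ∈ Lᗮ := by
      rw [hLorth]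
      refine ⟨fun x => ?_, hAe _ ?_⟩
      · rw [hz']
        exact Submodule.inner_right_of_mem_orthogonal (LinearMap.mem_range_self _ x) hz
      · rw [inner_sub_right, hw, hJe, sub_zero]
    -- Upper bound: compare with `h₀`, whose whitened residual already lies in `Lᗮ`. Lower bound:
    -- projection does not increase the norm.
    apply le_antisymm
    · rw [← hBJ w h₀, hBnorm, Submodule.norm_orthogonalProjectionOnto_apply Lᗮ hzL]
      exact hmin h₀
    · rw [← hBJ w h, hBnorm]
      gcongr
      exact Submodule.norm_orthogonalProjectionOnto_apply_le Lᗮ _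

/-- Uniformity comes from applying `tendsto_quad_minimizer_sub` on triples `(i, w, θ)`, with the
filter pulled back from `l` and restricted to admissible triples. -/
lemma eventually_abs_quad_minimizer_sub_lt {d k : ℕ} {ι : Type*} {l : Filter ι}
    {Θ : Set (Vec k)} (hΘ : IsOpen Θ) {p : Vec k → Vec d} (hbic : BicontinuousOn p Θ)
    {θ₀ : Vec k} (hθ₀ : θ₀ ∈ Θ) {J : Vec k →L[ℝ] Vec d} (hp : HasFDerivAt p J θ₀)
    (hJ : Function.Injective J) {N : ι → ℝ} (hN : Tendsto N l atTop)
    {S : ι → Matrix (Fin d) (Fin d) ℝ} {S₀ : Matrix (Fin d) (Fin d) ℝ} (hS : Tendsto S l (𝓝 S₀))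
    (hpos : ∀ x : Vec d, x ≠ 0 → 0 < quad S₀ x) {C : Set (Vec d)} (hC : IsClosed C)
    {g : Vec d → ℝ} (hg : Continuous g)
    (hgC : ∀ x ∈ C, ∀ h, (∀ h', quad S₀ (x - J h) ≤ quad S₀ (x - J h')) →
      quad S₀ (x - J h) = g x) (K : ℝ) {ε : ℝ} (hε : 0 < ε) :
    ∀ᶠ i in l, ∀ w ∈ C, ‖w‖ ≤ K → ∀ θ ∈ Θ,
      (∀ θ' ∈ Θ, quad (S i) (w - N i • (p θ - p θ₀)) ≤ quad (S i) (w - N i • (p θ' - p θ₀))) →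
      |quad (S i) (w - N i • (p θ - p θ₀)) - g w| < ε := by
  let A : Set (ι × (Vec d × Vec k)) := {z | z.2.1 ∈ C ∧ ‖z.2.1‖ ≤ K ∧ z.2.2 ∈ Θ ∧
    ∀ θ' ∈ Θ, quad (S z.1) (z.2.1 - N z.1 • (p z.2.2 - p θ₀))
      ≤ quad (S z.1) (z.2.1 - N z.1 • (p θ' - p θ₀))}
  have hfst : Tendsto Prod.fst (comap Prod.fst l ⊓ 𝓟 A) l := tendsto_comap.mono_left inf_le_left
  have hA : ∀ᶠ z in comap Prod.fst l ⊓ 𝓟 A, z ∈ A := mem_inf_of_right (mem_principal_self A)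
  have h := tendsto_quad_minimizer_sub hΘ hbic hθ₀ hp hJ (hN.comp hfst) (hS.comp hfst) hpos hC
    (w := fun z => z.2.1) (est := fun z => z.2.2) (hA.mono fun z hz => hz.2.1)
    (hA.mono fun z hz => hz.1) (hA.mono fun z hz => hz.2.2.1) (hA.mono fun z hz => hz.2.2.2) hg hgC
  have h' := h.eventually (Metric.ball_mem_nhds 0 hε)
  rw [eventually_inf_principal, eventually_comap] at h'
  filter_upwards [h'] with i hi w hwC hwK θ hθ hmin
  simpa using hi (i, (w, θ)) rfl ⟨hwC, hwK, hθ, hmin⟩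

/-! ### Continuity and measurability of the statistics. -/

/-- Holds for singular matrices too, both sides being `0`; hence the measurability below needs no
invertibility. -/
lemma Matrix.inv_eq_inv_det_smul_adjugate {d : ℕ} (A : Matrix (Fin d) (Fin d) ℝ) :
    A⁻¹ = A.det⁻¹ • A.adjugate := by
  rw [Matrix.inv_def, Ring.inverse_eq_inv']

lemma Matrix.continuousAt_inv_of_isUnit {d : ℕ} {A : Matrix (Fin d) (Fin d) ℝ}
    (hA : IsUnit A.det) : ContinuousAt (fun M : Matrix (Fin d) (Fin d) ℝ => M⁻¹) A := by
  simp only [Matrix.inv_eq_inv_det_smul_adjugate]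
  exact ((continuous_id.matrix_det.continuousAt).inv₀ hA.ne_zero).smul
    continuous_id.matrix_adjugate.continuousAt

lemma measurable_matrix_det {α : Type*} [MeasurableSpace α] {d : ℕ}
    {A : α → Matrix (Fin d) (Fin d) ℝ} (hA : ∀ i j, Measurable fun x => A x i j) :
    Measurable fun x => (A x).det := by
  simp only [Matrix.det_apply]
  fun_prop

lemma measurable_matrix_inv_apply {α : Type*} [MeasurableSpace α] {d : ℕ}
    {A : α → Matrix (Fin d) (Fin d) ℝ} (hA : ∀ i j, Measurable fun x => A x i j) (i j : Fin d) :
    Measurable fun x => (A x)⁻¹ i j := by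
  simp only [Matrix.inv_eq_inv_det_smul_adjugate, Matrix.smul_apply, Matrix.adjugate_apply,
    smul_eq_mul]
  refine (measurable_matrix_det hA).inv.mul (measurable_matrix_det fun a b => ?_)
  simp only [Matrix.updateRow_apply]
  split_ifs
  · exact measurable_const
  · exact hA a b

lemma measurable_middleMatrix_apply {d k : ℕ} {p : Vec k → Vec d} (hp : Measurable p)
    {φ : Vec d → Vec k} (hφ : Measurable φ) (n : ℕ) (ρ : ℝ) (i j : Fin d) :
    Measurable fun y => middleMatrix p φ n ρ y i j := by
  refine measurable_matrix_inv_apply (fun a b => ?_) i j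
  simp only [privCovar, Matrix.add_apply, Matrix.sub_apply, Matrix.diagonal_apply,
    Matrix.vecMulVec_apply]
  split_ifs <;> fun_prop

lemma measurable_quad {α : Type*} [MeasurableSpace α] {d : ℕ}
    {A : α → Matrix (Fin d) (Fin d) ℝ} (hA : ∀ i j, Measurable fun x => A x i j) {v : α → Vec d}
    (hv : Measurable v) : Measurable fun x => quad (A x) (v x) := by
  simp only [quad, dotProduct, Matrix.mulVec]
  fun_prop

lemma measurable_scaledDeviation {d k : ℕ} {p : Vec k → Vec d} (hp : Measurable p) (n : ℕ) :
    Measurable fun z : Vec d × Vec k => scaledDeviation p n z.1 z.2 := by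
  unfold scaledDeviation
  fun_prop

lemma measurable_unprojectedStat {d k : ℕ} {p : Vec k → Vec d} (hp : Measurable p)
    {φ : Vec d → Vec k} (hφ : Measurable φ) (n : ℕ) (ρ : ℝ) :
    Measurable fun z : Vec d × Vec k => unprojectedStat p φ n ρ z.1 z.2 :=
  measurable_quad (fun i j => (measurable_middleMatrix_apply hp hφ n ρ i j).comp measurable_fst)
    (measurable_scaledDeviation hp n)

lemma measurable_projectedStat {d k : ℕ} {p : Vec k → Vec d} (hp : Measurable p)
    {φ : Vec d → Vec k} (hφ : Measurable φ) (n : ℕ) (ρ : ℝ) :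
    Measurable fun z : Vec d × Vec k => projectedStat p φ n ρ z.1 z.2 := by
  refine measurable_quad (A := fun z : Vec d × Vec k =>
    centering d * middleMatrix p φ n ρ z.1 * centering d) (fun i j => ?_)
    (measurable_scaledDeviation hp n)
  have (a b : Fin d) : Measurable fun z : Vec d × Vec k => middleMatrix p φ n ρ z.1 a b :=
    (measurable_middleMatrix_apply hp hφ n ρ a b).comp measurable_fst
  simp only [Matrix.mul_apply]
  fun_prop

/-! ### The covariance matrix and the all-ones direction. -/

/-- The all-ones vector. -/
def onesVec (d : ℕ) : Vec d := WithLp.toLp 2 fun _ => 1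

lemma inner_onesVec {d : ℕ} (x : Vec d) : inner ℝ (onesVec d) x = ∑ i, x i := by
  simp [onesVec, PiLp.inner_apply]

lemma covar_isHermitian {d : ℕ} (q : Vec d) (a : ℝ) : (covar q a).IsHermitian := by
  ext i j
  simp [covar, Matrix.vecMulVec_apply, Matrix.diagonal_apply, Matrix.one_apply, eq_comm, mul_comm]
  grind

lemma quad_covar {d : ℕ} {q : Vec d} (h1 : ∑ i, q i = 1) (a : ℝ) (t : Vec d) :
    quad (covar q a) t = ∑ i, q i * (t i - ∑ j, q j * t j) ^ 2 + a * ‖t‖ ^ 2 :=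
  dotProduct_covar_mulVec h1 a t

lemma quad_add {d : ℕ} (S T : Matrix (Fin d) (Fin d) ℝ) (x : Vec d) :
    quad (S + T) x = quad S x + quad T x := by
  rw [quad, quad, quad, Matrix.add_mulVec, dotProduct_add]

lemma Matrix.posDef_of_quad_pos {d : ℕ} {S : Matrix (Fin d) (Fin d) ℝ} (hS : S.IsHermitian)
    (h : ∀ x : Vec d, x ≠ 0 → 0 < quad S x) : S.PosDef := by
  refine .of_dotProduct_mulVec_pos hS fun x hx => ?_
  simpa [quad] using h (WithLp.toLp 2 x) (by simpa using hx)

lemma Matrix.PosDef.quad_pos {d : ℕ} {S : Matrix (Fin d) (Fin d) ℝ} (hS : S.PosDef) (x : Vec d)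
    (hx : x ≠ 0) : 0 < quad S x := by
  simpa [quad] using hS.dotProduct_mulVec_pos (x := x.ofLp) (by simpa using hx)

lemma posDef_covar {d : ℕ} {q : Vec d} (h0 : ∀ i, 0 ≤ q i) (h1 : ∑ i, q i = 1) {a : ℝ}
    (ha : 0 < a) : (covar q a).PosDef := by
  refine Matrix.posDef_of_quad_pos (covar_isHermitian q a) fun x hx => ?_
  rw [quad_covar h1]
  have := norm_pos_iff.2 hx
  have : 0 ≤ ∑ i, q i * (x i - ∑ j, q j * x j) ^ 2 :=
    Finset.sum_nonneg fun i _ => mul_nonneg (h0 i) (sq_nonneg _)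
  positivity

/-- The projection `(1 / d) 𝟏𝟏ᵀ` onto the line of the all-ones vector. -/
def averaging (d : ℕ) : Matrix (Fin d) (Fin d) ℝ := (1 / (d : ℝ)) • Matrix.of fun _ _ => 1

lemma averaging_mulVec {d : ℕ} (x : Fin d → ℝ) :
    (averaging d).mulVec x = fun _ => (1 / (d : ℝ)) * ∑ i, x i := by
  ext i
  simp [averaging, Matrix.mulVec, dotProduct, Finset.mul_sum]

lemma quad_averaging {d : ℕ} (x : Vec d) : quad (averaging d) x = (∑ i, x i) ^ 2 / d := by
  rw [quad, averaging_mulVec, dotProduct, ← Finset.sum_mul]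
  ring

lemma averaging_isHermitian (d : ℕ) : (averaging d).IsHermitian := by
  ext i j; simp [averaging]

/-- When every `q i` is positive, zero variance forces `x` to be constant, and the averaging term
forces that constant to be `0`. -/
lemma posDef_covar_add_averaging {d : ℕ} {q : Vec d} (h0 : ∀ i, 0 ≤ q i) (h1 : ∑ i, q i = 1)
    {a : ℝ} (ha : 0 ≤ a) (h : 0 < a ∨ ∀ i, 0 < q i) : (covar q a + averaging d).PosDef := by
  refine Matrix.posDef_of_quad_pos ((covar_isHermitian q a).add (averaging_isHermitian d))
    fun x hx => ?_
  rw [quad_add, quad_covar h1, quad_averaging]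
  set m := ∑ j, q j * x j
  have hs : ∀ i ∈ Finset.univ, 0 ≤ q i * (x i - m) ^ 2 :=
    fun i _ => mul_nonneg (h0 i) (sq_nonneg _)
  have hs' := Finset.sum_nonneg hs
  have hx' := norm_pos_iff.2 hx
  rcases h with h | h
  · positivity
  · refine lt_of_le_of_ne (by positivity) fun hz => hx ?_
    have e1 : ∑ i, q i * (x i - m) ^ 2 = 0 := by
      have : 0 ≤ a * ‖x‖ ^ 2 := by positivity
      have : 0 ≤ (∑ i, x i) ^ 2 / (d : ℝ) := by positivity
      linarith
    have e2 : (∑ i, x i) ^ 2 / (d : ℝ) = 0 := by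
      have : 0 ≤ a * ‖x‖ ^ 2 := by positivity
      have : 0 ≤ (∑ i, x i) ^ 2 / (d : ℝ) := by positivity
      linarith
    have hxm (i : Fin d) : x i = m := by
      have := (Finset.sum_eq_zero_iff_of_nonneg hs).1 e1 i (Finset.mem_univ i)
      have := (mul_eq_zero.1 this).resolve_left (h i).ne'
      exact sub_eq_zero.1 (pow_eq_zero_iff two_ne_zero |>.1 this)
    ext i
    have hd : (d : ℝ) ≠ 0 := by
      have := i.pos
      positivity
    have e3 : ∑ i, x i = d * m := by simp [hxm]
    rw [e3] at e2
    have hm : m = 0 := by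
      rw [div_eq_zero_iff, or_iff_left hd] at e2
      exact (mul_eq_zero.1 (pow_eq_zero_iff two_ne_zero |>.1 e2)).resolve_left hd
    rw [hxm i, hm]; rfl

lemma covar_mulVec {d : ℕ} (q : Vec d) (a : ℝ) (x : Fin d → ℝ) :
    (covar q a).mulVec x = fun i => q i * x i - (∑ j, q j * x j) * q i + a * x i := by
  ext i
  rw [covar, Matrix.add_mulVec, Matrix.sub_mulVec, Matrix.vecMulVec_mulVec, Matrix.smul_mulVec,
    Matrix.one_mulVec]
  simp [Matrix.mulVec_diagonal, dotProduct, mul_comm]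

lemma sum_covar_mulVec {d : ℕ} {q : Vec d} (h1 : ∑ i, q i = 1) (a : ℝ) (x : Fin d → ℝ) :
    ∑ i, (covar q a).mulVec x i = a * ∑ i, x i := by
  simp only [covar_mulVec, Finset.sum_add_distrib, Finset.sum_sub_distrib, ← Finset.mul_sum, h1]
  ring

lemma covar_add_averaging_onesVec {d : ℕ} {q : Vec d} (h1 : ∑ i, q i = 1) (a : ℝ) :
    Matrix.toEuclideanCLM (𝕜 := ℝ) (covar q a + averaging d) (onesVec d)
      = (a + 1) • onesVec d := by
  ext i
  have hd : (d : ℝ) ≠ 0 := by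
    have := i.pos
    positivity
  rw [Matrix.ofLp_toEuclideanCLM, Matrix.add_mulVec, averaging_mulVec, covar_mulVec]
  simp [onesVec, h1, hd]

/-- Adding the projection onto the all-ones line does not change the inverse of the covariance
matrix on the orthogonal complement of that line. -/
lemma quad_inv_covar_eq {d : ℕ} {q : Vec d} (h0 : ∀ i, 0 ≤ q i) (h1 : ∑ i, q i = 1) {a : ℝ}
    (ha : 0 < a) {u : Vec d} (hu : ∑ i, u i = 0) :
    quad (covar q a)⁻¹ u = quad (covar q a + averaging d)⁻¹ u := by
  have hA : IsUnit (covar q a).det :=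
    (Matrix.isUnit_iff_isUnit_det _).1 (posDef_covar h0 h1 ha).isUnit
  have hB : IsUnit (covar q a + averaging d).det :=
    (Matrix.isUnit_iff_isUnit_det _).1 (posDef_covar_add_averaging h0 h1 ha.le (.inl ha)).isUnit
  set x := (covar q a)⁻¹.mulVec u.ofLp with hx
  have hAx : (covar q a).mulVec x = u.ofLp := by
    rw [hx, Matrix.mulVec_mulVec, Matrix.mul_nonsing_inv _ hA, Matrix.one_mulVec]
  -- `covar q a` multiplies coordinate sums by `a ≠ 0`, so `x` also sums to zero and averaging kills
  -- it.
  have hsum : ∑ i, x i = 0 := by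
    have := sum_covar_mulVec h1 a x
    rw [hAx, hu] at this
    exact (mul_eq_zero.1 this.symm).resolve_left ha.ne'
  have hBx : (covar q a + averaging d).mulVec x = u.ofLp := by
    rw [Matrix.add_mulVec, hAx, averaging_mulVec, hsum, mul_zero]
    exact add_zero _
  have hxB : (covar q a + averaging d)⁻¹.mulVec u.ofLp = x := by
    rw [← hBx, Matrix.mulVec_mulVec, Matrix.nonsing_inv_mul _ hB, Matrix.one_mulVec]
  rw [quad, quad, hxB]

/-! ### The noisy model and the limit law of the minimized statistic. -/

lemma chiSquare_eq_map_stdGaussian (m : ℕ) :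
    chiSquare m = (stdGaussian (Vec m)).map fun x => ‖x‖ ^ 2 := by
  rw [chiSquare, ← map_pi_eq_stdGaussian, Measure.map_map (by fun_prop) (by fun_prop)]
  congr 1
  ext x
  simp [EuclideanSpace.real_norm_sq_eq]

/-- A regular multinomial model with Gaussian noise added to the histograms, and a consistent
plug-in estimator `φ`. -/
structure NoisyMultinomial {d k : ℕ} {Ω : Type*} [MeasurableSpace Ω] (P : Measure Ω)
    (Θ : Set (Vec k)) (p : Vec k → Vec d) (θ₀ : Vec k) (ρ : ℕ → ℝ) (X Z : ℕ → Ω → Vec d)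
    (φ : Vec d → Vec k) : Prop where
  measurable : Measurable p
  regular : IsRegularModel Θ p
  mem : θ₀ ∈ Θ
  pos : ∀ n, 0 < ρ n
  hasLaw_multinomial : ∀ n, HasLaw (X n) (multinomial n (p θ₀)) P
  hasLaw_gaussian : ∀ n, HasLaw (Z n) (multivariateGaussian 0 ((1 / ρ n) • 1)) P
  indepFun : ∀ n, IndepFun (X n) (Z n) P
  measurable_plugin : Measurable φ
  tendsto_plugin : TendstoInMeasure P (fun n ω => φ (X n ω + Z n ω)) atTop fun _ => θ₀

lemma IsRegularModel.hasFDerivAt {d k : ℕ} {Θ : Set (Vec k)} {p : Vec k → Vec d}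
    (hp : IsRegularModel Θ p) {θ : Vec k} (hθ : θ ∈ Θ) : HasFDerivAt p (fderiv ℝ p θ) θ :=
  ((hp.contDiffOn.contDiffAt (hp.isOpen.mem_nhds hθ)).differentiableAt (by simp)).hasFDerivAt

lemma IsRegularModel.injective_fderiv {d k : ℕ} {Θ : Set (Vec k)} {p : Vec k → Vec d}
    (hp : IsRegularModel Θ p) {θ : Vec k} (hθ : θ ∈ Θ) : Function.Injective (fderiv ℝ p θ) := by
  have h := LinearMap.finrank_range_add_finrank_ker (fderiv ℝ p θ).toLinearMap
  rw [hp.rank_eq θ hθ, finrank_euclideanSpace_fin, Nat.add_eq_left, Submodule.finrank_eq_zero] at h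
  exact LinearMap.ker_eq_bot.1 h

/-- Differentiate the constraint that the probabilities sum to one, valid on a neighbourhood of `θ`.
-/
lemma IsRegularModel.sum_fderiv {d k : ℕ} {Θ : Set (Vec k)} {p : Vec k → Vec d}
    (hp : IsRegularModel Θ p) {θ : Vec k} (hθ : θ ∈ Θ) (h : Vec k) :
    ∑ i, fderiv ℝ p θ h i = 0 := by
  have h1 : HasFDerivAt (fun θ => inner ℝ (onesVec d) (p θ))
      (innerSL ℝ (onesVec d) ∘L fderiv ℝ p θ) θ :=
    (innerSL ℝ (onesVec d)).hasFDerivAt.comp θ (hp.hasFDerivAt hθ)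
  have h2 : HasFDerivAt (fun θ => inner ℝ (onesVec d) (p θ)) (0 : Vec k →L[ℝ] ℝ) θ := by
    refine (hasFDerivAt_const (1 : ℝ) θ).congr_of_eventuallyEq ?_
    filter_upwards [hp.isOpen.mem_nhds hθ] with x hx
    rw [inner_onesVec, hp.sum_eq_one x hx]
  have h3 := congr($(h1.unique h2) h)
  rw [← inner_onesVec]
  exact h3

lemma exists_forall_measure_norm_gt_le_of_tendsto_charFun {d : ℕ} {Ω : Type*} [MeasurableSpace Ω]
    {P : Measure Ω} [IsProbabilityMeasure P] {W : ℕ → Ω → Vec d} (hW : ∀ n, AEMeasurable (W n) P)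
    {f : Vec d → ℂ} (hf : Continuous f)
    (h : ∀ t, Tendsto (fun n => charFun (P.map (W n)) t) atTop (𝓝 (f t)))
    {η : ENNReal} (hη : 0 < η) : ∃ K : ℝ, ∀ n, P {ω | K < ‖W n ω‖} ≤ η := by
  have (n : ℕ) : IsProbabilityMeasure (P.map (W n)) := Measure.isProbabilityMeasure_map (hW n)
  obtain ⟨A, hA, hPA⟩ := isTightMeasureSet_iff_exists_isCompact_measure_compl_le.1
    (isTightMeasureSet_of_tendsto_charFun hf.continuousAt h) η hη
  obtain ⟨K, hK⟩ := hA.isBounded.exists_norm_le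
  refine ⟨K, fun n => ?_⟩
  have h1 := hPA _ (Set.mem_range_self n)
  rw [Measure.map_apply_of_aemeasurable (hW n) hA.measurableSet.compl] at h1
  refine (measure_mono fun ω hω hmem => ?_).trans h1
  exact absurd (hK _ hmem) (not_le.2 hω)

lemma continuous_covar {d : ℕ} : Continuous fun z : Vec d × ℝ => covar z.1 z.2 := by
  unfold covar
  have h : Continuous fun z : Vec d × ℝ => z.1.ofLp := by fun_prop
  exact (h.matrix_diagonal.sub (h.matrix_vecMulVec h)).add (continuous_snd.smul continuous_const)

lemma privCovar_eq_covar {d k : ℕ} (p : Vec k → Vec d) (r : ℝ) (θ : Vec k) :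
    privCovar p r θ = covar (p θ) (1 / r) := rfl

/-- The plug-in value is a free variable near `θ₀`, which keeps the later comparison deterministic.
-/
lemma tendsto_inv_privCovar_add {d k : ℕ} {p : Vec k → Vec d} {θ₀ : Vec k}
    (hp : ContinuousAt p θ₀) {r : ℕ → ℝ} {a : ℝ}
    (ha : Tendsto (fun n => 1 / r n) atTop (𝓝 a)) {E : Matrix (Fin d) (Fin d) ℝ}
    (hG : (covar (p θ₀) a + E).PosDef) :
    Tendsto (fun z : ℕ × Vec k => (privCovar p (r z.1) z.2 + E)⁻¹)
      (atTop ×ˢ 𝓝 θ₀) (𝓝 (covar (p θ₀) a + E)⁻¹) := by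
  have h1 : Tendsto (fun z : ℕ × Vec k => (p z.2, 1 / r z.1)) (atTop ×ˢ 𝓝 θ₀) (𝓝 (p θ₀, a)) :=
    (hp.tendsto.comp tendsto_snd).prodMk_nhds (ha.comp tendsto_fst)
  have h2 := ((continuous_covar.tendsto (p θ₀, a)).comp h1).add_const E
  exact (Matrix.continuousAt_inv_of_isUnit
    ((Matrix.isUnit_iff_isUnit_det _).1 hG.isUnit)).tendsto.comp h2

lemma tendstoInDistribution_norm_sq_chiSquare {m : ℕ} {Ω : Type*} [MeasurableSpace Ω]
    {P : Measure Ω} [IsProbabilityMeasure P] {V : ℕ → Ω → Vec m}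
    (hV : TendstoInDistribution V atTop id (fun _ => P) (stdGaussian (Vec m))) :
    TendstoInDistribution (fun n ω => ‖V n ω‖ ^ 2) atTop id (fun _ => P) (chiSquare m) := by
  have h := hV.continuous_comp (g := fun x => ‖x‖ ^ 2) (by fun_prop)
  refine ⟨h.forall_aemeasurable, aemeasurable_id, ?_⟩
  have e : (⟨(chiSquare m).map id, Measure.isProbabilityMeasure_map aemeasurable_id⟩ :
      ProbabilityMeasure ℝ) = ⟨(stdGaussian (Vec m)).map ((fun x => ‖x‖ ^ 2) ∘ id),
        Measure.isProbabilityMeasure_map h.aemeasurable_limit⟩ := by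
    apply Subtype.ext
    change (chiSquare m).map id = (stdGaussian (Vec m)).map ((fun x => ‖x‖ ^ 2) ∘ id)
    rw [Measure.map_id, chiSquare_eq_map_stdGaussian]
    rfl
  rw [e]
  exact h.tendsto

/-- Asymptotics of a minimum chi-square statistic: the statistic is, for parameters in `Θ`, the
quadratic form with matrix `(Σ + E)⁻¹` at the scaled deviation with its component along a vector
`e` removed. -/
theorem NoisyMultinomial.tendstoInDistribution {d k : ℕ} {Ω : Type*} [MeasurableSpace Ω]
    {P : Measure Ω} [IsProbabilityMeasure P] {Θ : Set (Vec k)} {p : Vec k → Vec d} {θ₀ : Vec k}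
    {ρ : ℕ → ℝ} {X Z : ℕ → Ω → Vec d} {φ : Vec d → Vec k}
    (H : NoisyMultinomial P Θ p θ₀ ρ X Z φ) {a : ℝ}
    (ha : Tendsto (fun n : ℕ => 1 / ((n : ℝ) * ρ n)) atTop (𝓝 a))
    {E : Matrix (Fin d) (Fin d) ℝ} (hG : (covar (p θ₀) a + E).PosDef) {e : Vec d} {c : ℝ}
    (hc : c ≠ 0) (hGe : Matrix.toEuclideanCLM (𝕜 := ℝ) (covar (p θ₀) a + E) e = c • e)
    (hJe : ∀ h, inner ℝ e (fderiv ℝ p θ₀ h) = 0) {F : Vec d →L[ℝ] Vec d}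
    (hFe : ∀ w, inner ℝ e (F w) = 0)
    (hF : ∀ t, inner ℝ e t = 0 → ∀ w, inner ℝ (F w) t = inner ℝ w t)
    (hE : ∀ t, inner ℝ e t = 0 → quad E t = 0)
    {T : ℕ → Vec d → Vec k → ℝ} (hTm : ∀ n, Measurable fun z : Vec d × Vec k => T n z.1 z.2)
    (hT : ∀ n, 0 < n → ∀ y θ, φ y ∈ Θ → θ ∈ Θ → T n y θ = quad (privCovar p (n * ρ n) (φ y) + E)⁻¹
      (F (scaledDeviation p n y θ₀) - √(n : ℝ) • (p θ - p θ₀)))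
    {est : ℕ → Ω → Vec k}
    (hest : IsMinChiSqEstimator P Θ (fun n ω => T n (X n ω + Z n ω)) est) :
    TendstoInDistribution (fun n ω => T n (X n ω + Z n ω) (est n ω)) atTop id (fun _ => P)
      (chiSquare (d - k - Module.finrank ℝ (ℝ ∙ e))) := by
  have h0 := H.regular.nonneg θ₀ H.mem
  have h1 := H.regular.sum_eq_one θ₀ H.mem
  have hYm (n : ℕ) : AEMeasurable (fun ω => X n ω + Z n ω) P :=
    (H.hasLaw_multinomial n).aemeasurable.add (H.hasLaw_gaussian n).aemeasurable
  set W : ℕ → Ω → Vec d := fun n ω => scaledDeviation p n (X n ω + Z n ω) θ₀ with hW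
  have hWm (n : ℕ) : AEMeasurable (W n) P :=
    ((measurable_scaledDeviation H.measurable n).comp
      (measurable_id.prodMk measurable_const)).comp_aemeasurable (hYm n)
  have hWchar (t : Vec d) : Tendsto (fun n => charFun (P.map (W n)) t) atTop
      (𝓝 (Complex.exp ((-(quad (covar (p θ₀) a) t) / 2 : ℝ)))) :=
    tendsto_charFun_scaled h0 h1 H.pos H.hasLaw_multinomial H.hasLaw_gaussian H.indepFun ha t
  have hchar_cont : Continuous fun t : Vec d =>
      Complex.exp ((-(quad (covar (p θ₀) a) t) / 2 : ℝ)) := by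
    have : Continuous fun t : Vec d => quad (covar (p θ₀) a) t :=
      continuous_quad.comp (by fun_prop : Continuous fun t : Vec d => (covar (p θ₀) a, t))
    fun_prop
  obtain ⟨B, D, hBe, hBD, hD, hB⟩ := exists_residual_map hG hc hGe
    (H.regular.injective_fderiv H.mem) hJe
  have hDe (s) : inner ℝ e (D s) = 0 := by rw [← hBD, hBe, inner_zero_left]
  -- `B` ignores the component along `e`, so the limit law of `W` can be used without projecting it.
  have hBF (w : Vec d) : B (F w) = B w := by
    refine ext_inner_right ℝ fun s => ?_
    rw [hBD, hBD, hF _ (hDe s)]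
  have hBW : TendstoInDistribution (fun n ω => B (W n ω)) atTop id (fun _ => P)
      (stdGaussian (Vec (d - k - Module.finrank ℝ (ℝ ∙ e)))) := by
    refine ⟨fun n => B.continuous.measurable.comp_aemeasurable (hWm n), aemeasurable_id, ?_⟩
    refine ProbabilityMeasure.tendsto_iff_tendsto_charFun.2 fun s => ?_
    -- `E` vanishes on the range of `D`, so whitening for `G` also whitens the true covariance
    -- there.
    have hs : quad (covar (p θ₀) a) (D s) = ‖s‖ ^ 2 := by
      rw [← hD s, quad_add, hE _ (hDe s), add_zero]
    have h2 := hWchar (D s)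
    rw [hs] at h2
    simp only [ProbabilityMeasure.coe_mk, Measure.map_id, charFun_stdGaussian]
    push_cast at h2
    refine h2.congr fun n => ?_
    have hm : AEMeasurable (fun ω => B (W n ω)) P :=
      B.continuous.measurable.comp_aemeasurable (hWm n)
    rw [charFun_apply, charFun_apply, integral_map (hWm n) (by fun_prop),
      integral_map hm (by fun_prop)]
    simp only [hBD]
  refine tendstoInDistribution_of_tendstoInMeasure_sub _ _
    (tendstoInDistribution_norm_sq_chiSquare hBW) ?_ fun n =>
    (hTm n).comp_aemeasurable ((hYm n).prodMk (hest.aemeasurable n))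
  rw [tendstoInMeasure_iff_norm]
  intro ε hε
  rw [ENNReal.tendsto_nhds_zero]
  intro η hη
  -- One third for each bad event: large `W`, plug-in far from `θ₀`, failure of the minimizer.
  have hη3 : 0 < η / 3 := ENNReal.div_pos hη.ne' (by simp)
  obtain ⟨K, hK⟩ := exists_forall_measure_norm_gt_le_of_tendsto_charFun hWm hchar_cont hWchar hη3
  have hN : Tendsto (fun z : ℕ × Vec k => √(z.1 : ℝ)) (atTop ×ˢ 𝓝 θ₀) atTop :=
    (Real.tendsto_sqrt_atTop.comp tendsto_natCast_atTop_atTop).comp tendsto_fst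
  have hS := tendsto_inv_privCovar_add (H.regular.hasFDerivAt H.mem).continuousAt ha hG
  have hdet := eventually_abs_quad_minimizer_sub_lt H.regular.isOpen H.regular.bicontinuous H.mem
    (H.regular.hasFDerivAt H.mem) (H.regular.injective_fderiv H.mem) hN hS hG.inv.quad_pos
    (C := {w | inner ℝ e w = 0}) (isClosed_eq (by fun_prop) continuous_const)
    (g := fun w => ‖B w‖ ^ 2) (by fun_prop) hB (‖F‖ * K) hε
  obtain ⟨pa, hpa, pb, hpb, hab⟩ := eventually_prod_iff.1 hdet
  obtain ⟨δ, hδ, hball⟩ := Metric.eventually_nhds_iff.1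
    (hpb.and (H.regular.isOpen.mem_nhds H.mem))
  have hφ := (tendstoInMeasure_iff_norm.1 H.tendsto_plugin) δ hδ
  filter_upwards [hpa, eventually_gt_atTop 0, ENNReal.tendsto_nhds_zero.1 hφ _ hη3,
    ENNReal.tendsto_nhds_zero.1 hest.argmin _ hη3] with n hn hn0 hφn hargn
  calc P {ω | ε ≤ ‖((fun n ω => T n (X n ω + Z n ω) (est n ω)) - fun n ω => ‖B (W n ω)‖ ^ 2) n ω
        - (0 : ℕ → Ω → ℝ) n ω‖}
      ≤ P ({ω | K < ‖W n ω‖} ∪ {ω | δ ≤ ‖φ (X n ω + Z n ω) - θ₀‖} ∪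
          {ω | ¬ (est n ω ∈ Θ ∧ IsMinOn (T n (X n ω + Z n ω)) Θ (est n ω))}) := by
        refine measure_mono fun ω hω => ?_
        by_contra hcon
        simp only [Set.mem_union, Set.mem_ofPred_eq, not_or, not_lt, not_le, not_not] at hcon
        obtain ⟨⟨hWK, hφδ⟩, hestΘ, hmin⟩ := hcon
        obtain ⟨hpbω, hφΘ⟩ := hball (by rwa [dist_eq_norm] :
          dist (φ (X n ω + Z n ω)) θ₀ < δ)
        have h3 := hab hn hpbω (F (W n ω)) (hFe _)
          ((F.le_opNorm _).trans (by gcongr)) (est n ω) hestΘ (fun θ' hθ' => by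
            have h4 := hmin hθ'
            simp only [Set.mem_ofPred_eq] at h4
            rwa [hT n hn0 _ _ hφΘ hestΘ, hT n hn0 _ _ hφΘ hθ'] at h4)
        rw [hBF] at h3
        have h5 := hT n hn0 (X n ω + Z n ω) (est n ω) hφΘ hestΘ
        simp only [Set.mem_ofPred_eq, Pi.sub_apply, Pi.zero_apply, sub_zero, Real.norm_eq_abs,
          h5] at hω
        exact absurd h3 (not_lt.2 hω)
    _ ≤ η / 3 + η / 3 + η / 3 :=
        (measure_union_le _ _).trans
          (add_le_add ((measure_union_le _ _).trans (add_le_add (hK n) hφn)) hargn)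
    _ = η := ENNReal.add_thirds η

/-! ### Centering, and the two choices of the removed direction. -/

lemma scaledDeviation_eq_sub {d k : ℕ} (p : Vec k → Vec d) (n : ℕ) (y : Vec d) (θ θ₀ : Vec k) :
    scaledDeviation p n y θ = scaledDeviation p n y θ₀ - √(n : ℝ) • (p θ - p θ₀) := by
  simp only [scaledDeviation, smul_sub]
  abel

lemma toEuclideanCLM_centering {d : ℕ} (x : Vec d) :
    Matrix.toEuclideanCLM (𝕜 := ℝ) (centering d) x
      = x - ((1 / (d : ℝ)) * ∑ i, x i) • onesVec d := by
  ext i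
  rw [Matrix.ofLp_toEuclideanCLM, show centering d = 1 - averaging d from rfl, Matrix.sub_mulVec,
    Matrix.one_mulVec, averaging_mulVec]
  simp [onesVec]

lemma inner_onesVec_centering {d : ℕ} (x : Vec d) :
    inner ℝ (onesVec d) (Matrix.toEuclideanCLM (𝕜 := ℝ) (centering d) x) = 0 := by
  rw [toEuclideanCLM_centering, inner_sub_right, inner_smul_right, inner_onesVec, inner_onesVec]
  rcases Nat.eq_zero_or_pos d with rfl | hd
  · simp
  · have : (d : ℝ) ≠ 0 := by positivity
    simp only [onesVec, Finset.sum_const, Finset.card_univ, Fintype.card_fin, nsmul_eq_mul]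
    field_simp
    ring

lemma centering_transpose (d : ℕ) : (centering d).transpose = centering d := by
  rw [centering, Matrix.transpose_sub, Matrix.transpose_one, Matrix.transpose_smul]
  rfl

lemma quad_centering_mul_mul {d : ℕ} (M : Matrix (Fin d) (Fin d) ℝ) (x : Vec d) :
    quad (centering d * M * centering d) x
      = quad M (Matrix.toEuclideanCLM (𝕜 := ℝ) (centering d) x) := by
  simp only [quad, Matrix.ofLp_toEuclideanCLM]
  rw [← Matrix.mulVec_mulVec, ← Matrix.mulVec_mulVec, Matrix.dotProduct_mulVec,
    ← Matrix.mulVec_transpose, centering_transpose]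

namespace NoisyMultinomial

variable {d k : ℕ} {Ω : Type*} [MeasurableSpace Ω] {P : Measure Ω} [IsProbabilityMeasure P]
  {Θ : Set (Vec k)} {p : Vec k → Vec d} {θ₀ : Vec k} {ρ : ℕ → ℝ} {X Z : ℕ → Ω → Vec d}
  {φ : Vec d → Vec k}

theorem tendstoInDistribution_unprojectedStat (H : NoisyMultinomial P Θ p θ₀ ρ X Z φ) {a : ℝ}
    (ha0 : 0 < a) (ha : Tendsto (fun n : ℕ => 1 / ((n : ℝ) * ρ n)) atTop (𝓝 a))
    {est : ℕ → Ω → Vec k}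
    (hest : IsMinChiSqEstimator P Θ
      (fun n ω => unprojectedStat p φ n (ρ n) (X n ω + Z n ω)) est) :
    TendstoInDistribution (fun n ω => unprojectedStat p φ n (ρ n) (X n ω + Z n ω) (est n ω))
      atTop id (fun _ => P) (chiSquare (d - k)) := by
  -- Nothing is removed: with `e = 0` any nonzero eigenvalue `c` will do.
  have h := H.tendstoInDistribution ha (E := 0) (e := 0) (c := 1)
    (F := ContinuousLinearMap.id ℝ (Vec d)) (T := fun n => unprojectedStat p φ n (ρ n))
    (by rw [add_zero]
        exact posDef_covar (H.regular.nonneg θ₀ H.mem) (H.regular.sum_eq_one θ₀ H.mem) ha0)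
    one_ne_zero (by simp) (by simp) (by simp) (fun _ _ _ => rfl) (by simp [quad])
    (fun n => measurable_unprojectedStat H.measurable H.measurable_plugin n (ρ n))
    (fun n _ y θ _ _ => by
      rw [add_zero, ContinuousLinearMap.id_apply, ← scaledDeviation_eq_sub]
      rfl) hest
  rw [Submodule.span_zero_singleton, finrank_bot] at h
  exact h

theorem tendstoInDistribution_projectedStat (H : NoisyMultinomial P Θ p θ₀ ρ X Z φ) {a : ℝ}
    (ha0 : 0 ≤ a) (ha0' : 0 < a ∨ ∀ i, 0 < p θ₀ i)
    (ha : Tendsto (fun n : ℕ => 1 / ((n : ℝ) * ρ n)) atTop (𝓝 a)) {est : ℕ → Ω → Vec k}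
    (hest : IsMinChiSqEstimator P Θ
      (fun n ω => projectedStat p φ n (ρ n) (X n ω + Z n ω)) est) :
    TendstoInDistribution (fun n ω => projectedStat p φ n (ρ n) (X n ω + Z n ω) (est n ω))
      atTop id (fun _ => P) (chiSquare (d - k - 1)) := by
  have h0 := H.regular.nonneg θ₀ H.mem
  have h1 := H.regular.sum_eq_one θ₀ H.mem
  have hones : onesVec d ≠ 0 := by
    intro hz
    have h2 := inner_onesVec (p θ₀)
    rw [hz, inner_zero_left, h1] at h2
    exact zero_ne_one h2
  have h := H.tendstoInDistribution ha (E := averaging d) (e := onesVec d) (c := a + 1)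
    (F := Matrix.toEuclideanCLM (𝕜 := ℝ) (centering d))
    (T := fun n => projectedStat p φ n (ρ n))
    (posDef_covar_add_averaging h0 h1 ha0 ha0') (by positivity) (covar_add_averaging_onesVec h1 a)
    (fun h => by rw [inner_onesVec, H.regular.sum_fderiv H.mem])
    inner_onesVec_centering
    (fun t ht w => by
      rw [toEuclideanCLM_centering, inner_sub_left, real_inner_smul_left, ht, mul_zero, sub_zero])
    (fun t ht => by
      rw [inner_onesVec] at ht
      rw [quad_averaging, ht]
      simp)
    (fun n => measurable_projectedStat H.measurable H.measurable_plugin n (ρ n))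
    (fun n hn y θ hy hθ => by
      have hfix : Matrix.toEuclideanCLM (𝕜 := ℝ) (centering d) (p θ - p θ₀) = p θ - p θ₀ := by
        rw [toEuclideanCLM_centering]
        simp [H.regular.sum_eq_one θ hθ, h1]
      -- The limit `a` may be `0`, but the noise is positive at each finite `n > 0`, as
      -- `quad_inv_covar_eq` requires.
      have hpos : 0 < 1 / ((n : ℝ) * ρ n) := by
        have := H.pos n
        have : (0 : ℝ) < n := by exact_mod_cast hn
        positivity
      have h2 : Matrix.toEuclideanCLM (𝕜 := ℝ) (centering d) (scaledDeviation p n y θ₀)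
          - √(n : ℝ) • (p θ - p θ₀)
          = Matrix.toEuclideanCLM (𝕜 := ℝ) (centering d) (scaledDeviation p n y θ) := by
        rw [scaledDeviation_eq_sub p n y θ θ₀, map_sub, map_smul, hfix]
      rw [h2, privCovar_eq_covar, ← quad_inv_covar_eq (H.regular.nonneg _ hy)
        (H.regular.sum_eq_one _ hy) hpos (by rw [← inner_onesVec, inner_onesVec_centering]),
        ← quad_centering_mul_mul]
      rfl) hest
  rwa [finrank_span_singleton hones] at h

end NoisyMultinomial

theorem mainTheorem1 {d k : ℕ} {Ω : Type*} [MeasurableSpace Ω]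
    (P : Measure Ω) [IsProbabilityMeasure P]
    (Θ : Set (Vec k)) (p : Vec k → Vec d) (hp_meas : Measurable p) (hp : IsRegularModel Θ p)
    (θ₀ : Vec k) (hθ₀ : θ₀ ∈ Θ)
    (ρ : ℕ → ℝ) (hρ : ∀ n, 0 < ρ n)
    (X Z : ℕ → Ω → Vec d)
    (hX : ∀ n, HasLaw (X n) (multinomial n (p θ₀)) P)
    (hZ : ∀ n, HasLaw (Z n) (multivariateGaussian 0 ((1 / ρ n) • 1)) P)
    (hXZ : ∀ n, IndepFun (X n) (Z n) P)
    (φ : Vec d → Vec k) (hφ_meas : Measurable φ)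
    (hφ : TendstoInMeasure P (fun n ω => φ (X n ω + Z n ω)) atTop (fun _ => θ₀)) :
    -- unprojected statistic, `n ρ_n → r > 0`
    (∀ r : ℝ, 0 < r → Tendsto (fun n : ℕ => (n : ℝ) * ρ n) atTop (𝓝 r) →
      ∀ est : ℕ → Ω → Vec k,
        IsMinChiSqEstimator P Θ
          (fun n ω => unprojectedStat p φ n (ρ n) (X n ω + Z n ω)) est →
        TendstoInDistribution
          (fun n ω => unprojectedStat p φ n (ρ n) (X n ω + Z n ω) (est n ω))
          atTop id (fun _ => P) (chiSquare (d - k))) ∧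
    -- projected statistic, `n ρ_n → r > 0`
    (∀ r : ℝ, 0 < r → Tendsto (fun n : ℕ => (n : ℝ) * ρ n) atTop (𝓝 r) →
      ∀ est : ℕ → Ω → Vec k,
        IsMinChiSqEstimator P Θ
          (fun n ω => projectedStat p φ n (ρ n) (X n ω + Z n ω)) est →
        TendstoInDistribution
          (fun n ω => projectedStat p φ n (ρ n) (X n ω + Z n ω) (est n ω))
          atTop id (fun _ => P) (chiSquare (d - k - 1))) ∧
    -- projected statistic, `n ρ_n → ∞`
    ((∀ i, 0 < p θ₀ i) → Tendsto (fun n : ℕ => (n : ℝ) * ρ n) atTop atTop →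
      ∀ est : ℕ → Ω → Vec k,
        IsMinChiSqEstimator P Θ
          (fun n ω => projectedStat p φ n (ρ n) (X n ω + Z n ω)) est →
        TendstoInDistribution
          (fun n ω => projectedStat p φ n (ρ n) (X n ω + Z n ω) (est n ω))
          atTop id (fun _ => P) (chiSquare (d - k - 1))) := by
  have H : NoisyMultinomial P Θ p θ₀ ρ X Z φ :=
    ⟨hp_meas, hp, hθ₀, hρ, hX, hZ, hXZ, hφ_meas, hφ⟩
  have hinv {r : ℝ} (hr : 0 < r) (h : Tendsto (fun n : ℕ => (n : ℝ) * ρ n) atTop (𝓝 r)) :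
      Tendsto (fun n : ℕ => 1 / ((n : ℝ) * ρ n)) atTop (𝓝 (1 / r)) :=
    tendsto_const_nhds.div h hr.ne'
  refine ⟨fun r hr h est hest => ?_, fun r hr h est hest => ?_, fun hq h est hest => ?_⟩
  · exact H.tendstoInDistribution_unprojectedStat (one_div_pos.2 hr) (hinv hr h) hest
  · exact H.tendstoInDistribution_projectedStat (one_div_pos.2 hr).le (.inl (one_div_pos.2 hr))
      (hinv hr h) hest
  -- The case `a = 0`, where positivity of the cell probabilities supplies invertibility.
  · refine H.tendstoInDistribution_projectedStat le_rfl (.inr hq) ?_ hest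
    simpa only [one_div, Function.comp_def] using tendsto_inv_atTop_zero.comp h

end
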